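/- Let $D$ be a finite (nonempty) distributive lattice with least element $0$ and greatest element $1$. Let $J(D)$ be the set of its nonzero join-irreducible elements and $J^+(D)=J(D)\cup\{0,1\}$. A $J(D)$-colored chain consists of a finite nonempty chain $C$ and a surjective map $\gamma$ from the set of prime intervals $[x,y]$ ($x\prec y$) of $C$ onto $J(D)$. The element of $D$ represented by an interval $I=[x,y]$ ($x\le y$) of $C$ is the join in $D$ of the colors $\gamma(\mathfrak p)$ of all prime intervals $\mathfrak p$ of $C$ contained in $I$ (the empty join being $0$), and the set represented by the colored chain is the set of the elements represented by all intervals of $C$. The lattice $D$ is called fully chain-representable if every set $Q$ with $J^+(D)\subseteq Q\subseteq D$ is the set represented by some $J(D)$-colored chain. The lattice $D$ is called planar if it has a planar Hasse diagram, that is, its elements can be drawn as distinct points of the plane, larger elements placed higher, with each covering pair $a\prec b$ drawn as a straight line segment, so that these segments pass through no elements other than their endpoints and two distinct segments meet at most in a common endpoint. An element is join-reducible if it is the join of two strictly smaller elements. Then $D$ is fully chain-representable if and only if $D$ is planar and has at most one join-reducible coatom. -/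

import Mathlib

/-- The nonzero join-irreducible elements `J(D)` (`SupIrred` excludes the least element). -/
abbrev JoinIrr (D : Type*) [SemilatticeSup D] : Type _ := {a : D // SupIrred a}

/-- `J⁺(D)`: the nonzero join-irreducible elements together with `0` and `1`. -/
def JPlus (D : Type*) [SemilatticeSup D] [BoundedOrder D] : Set D :=
  {a | SupIrred a} ∪ {⊥, ⊤}

/-- `a` is the join of two elements strictly below it. -/
def JoinReducible {D : Type*} [SemilatticeSup D] (a : D) : Prop :=
  ∃ b c : D, b < a ∧ c < a ∧ b ⊔ c = a

/-- The prime intervals `[x, y]`, `x ⋖ y`, of an ordered set, given by their endpoints. -/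
abbrev PrimeInterval (C : Type*) [Preorder C] : Type _ := {p : C × C // p.1 ⋖ p.2}

/-- The element of `D` represented by an interval `I` of a chain `C` whose prime intervals are
colored by `J(D)`: the join of the colors of all prime intervals of `C` contained in `I`
(so `⊥` if `I` is a singleton). -/
noncomputable def intervalRep {C D : Type*} [LinearOrder C] [Finite C]
    [SemilatticeSup D] [OrderBot D] (color : PrimeInterval C → JoinIrr D)
    (I : NonemptyInterval C) : D :=
  (Set.toFinite {p : PrimeInterval C | I.fst ≤ p.1.1 ∧ p.1.2 ≤ I.snd}).toFinset.sup
    fun p => (color p : D)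

/-- The set represented by a colored chain. -/
def representedSet {C D : Type*} [LinearOrder C] [Finite C]
    [SemilatticeSup D] [OrderBot D] (color : PrimeInterval C → JoinIrr D) : Set D :=
  Set.range (intervalRep color)

/-- The inclusion `Q ⊆ D` is chain-representable: `Q` is the set represented by some finite
(nonempty) chain `C` with a surjective coloring of its prime intervals by `J(D)`.
Every finite chain has an isomorphic copy in `Type`. -/
def ChainRepresentable {D : Type*} [SemilatticeSup D] [OrderBot D] (Q : Set D) : Prop :=
  ∃ (C : Type) (_ : LinearOrder C) (_ : Finite C) (_ : Nonempty C)
    (color : PrimeInterval C → JoinIrr D),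
    Function.Surjective color ∧ Q = representedSet color

/-- Every `Q` with `J⁺(D) ⊆ Q ⊆ D` is chain-representable. -/
def FullyChainRepresentable (D : Type*) [SemilatticeSup D] [BoundedOrder D] : Prop :=
  ∀ Q : Set D, JPlus D ⊆ Q → ChainRepresentable Q

/-- `pos` is a planar (Hasse) diagram of the ordered set `D`: distinct elements are distinct
points of the plane, larger elements are placed higher, each covering pair `a ⋖ b` is drawn as the
straight line segment from `pos a` to `pos b`, edges pass through no elements other than their
endpoints, and two distinct edges meet at most at a common endpoint. -/
structure IsPlanarDiagram {D : Type*} [PartialOrder D] (pos : D → ℝ × ℝ) : Prop where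
  injective : Function.Injective pos
  upward : ∀ a b : D, a < b → (pos a).2 < (pos b).2
  vertex_edge : ∀ a b v : D, a ⋖ b → pos v ∈ segment ℝ (pos a) (pos b) → v = a ∨ v = b
  edge_edge : ∀ a b c d : D, a ⋖ b → c ⋖ d → (a, b) ≠ (c, d) →
    ∀ P : ℝ × ℝ, P ∈ segment ℝ (pos a) (pos b) → P ∈ segment ℝ (pos c) (pos d) →
      ∃ v : D, (v = a ∨ v = b) ∧ (v = c ∨ v = d) ∧ P = pos v

/-- A finite ordered set is planar if it has a planar diagram. -/
def IsPlanarOrder (D : Type*) [PartialOrder D] : Prop :=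
  Finite D ∧ ∃ pos : D → ℝ × ℝ, IsPlanarDiagram pos

/-! Both sides amount to: `J(D)` has no three pairwise incomparable elements (`JoinIrrWidthLETwo`),
and at most one coatom is join-reducible. A colored chain is a word using every letter of `J(D)`,
and it represents the joins of the factors of that word. In a distributive lattice join-irreducibles
are join-prime, which drives every step.

Necessity is tested on `J⁺(D)` plus one element. With an antichain `a, b, c` of letters, `a ⊔ b ⊔ c`
cannot be built up letter by letter (`wordJoin_le_of_three_antichain`). With two join-reducible
coatoms `c, c'`, a factor with join `c ⊓ c'` can never grow to `⊤`
(`wordJoin_append_eq_of_absorbing`). For sufficiency, every nonzero `y` is a join of two letters,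
and some letter `p` is `⊤` or a coatom; the word `p f(y) g(y) p f(y') g(y') p ...` represents
exactly `Q`, since a factor containing `p` has join `p` or `⊤`.

Width two gives planarity by splitting `J(D)` into two chains: counting members below an element
embeds `D` in a grid. Conversely, an antichain of three letters yields an element with three covers,
hence a cube, which has no planar diagram (`not_three_covers`). -/

/-- The join of the letters of a word over `J(D)`. -/
def wordJoin {D : Type*} [SemilatticeSup D] [OrderBot D] (u : List (JoinIrr D)) : D :=
  u.foldr (fun x d => (x : D) ⊔ d) ⊥

/-- The set of joins of the factors (contiguous subwords) of a word. -/
def factorJoins {D : Type*} [SemilatticeSup D] [OrderBot D] (w : List (JoinIrr D)) : Set D :=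
  {d | ∃ u, u <:+: w ∧ wordJoin u = d}

/-! ### Colored chains as words over `J(D)`. -/

section Words

variable {D : Type*} [SemilatticeSup D] [OrderBot D]

@[simp] theorem wordJoin_nil : wordJoin ([] : List (JoinIrr D)) = ⊥ := rfl

@[simp] theorem wordJoin_cons (x : JoinIrr D) (u : List (JoinIrr D)) :
    wordJoin (x :: u) = (x : D) ⊔ wordJoin u := rfl

@[simp] theorem wordJoin_append (u v : List (JoinIrr D)) :
    wordJoin (u ++ v) = wordJoin u ⊔ wordJoin v := by
  induction u with
  | nil => simp
  | cons x u ih => simp [ih, sup_assoc]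

theorem wordJoin_le_iff {u : List (JoinIrr D)} {z : D} :
    wordJoin u ≤ z ↔ ∀ x ∈ u, (x : D) ≤ z := by
  induction u with
  | nil => simp
  | cons x u ih => rw [wordJoin_cons, sup_le_iff, ih, List.forall_mem_cons]

theorem le_wordJoin {u : List (JoinIrr D)} {x : JoinIrr D} (hx : x ∈ u) :
    (x : D) ≤ wordJoin u :=
  wordJoin_le_iff.1 le_rfl x hx

theorem intervalRep_le_iff {C : Type*} [LinearOrder C] [Finite C]
    {color : PrimeInterval C → JoinIrr D} {I : NonemptyInterval C} {z : D} :
    intervalRep color I ≤ z ↔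
      ∀ p : PrimeInterval C, I.fst ≤ p.1.1 → p.1.2 ≤ I.snd → (color p : D) ≤ z := by
  simp [intervalRep, Finset.sup_le_iff]

theorem PrimeInterval.val_snd_eq {C : Type*} [LinearOrder C] {n : ℕ} (e : C ≃o Fin (n + 1))
    (p : PrimeInterval C) : (e p.1.2 : ℕ) = e p.1.1 + 1 := by
  have h : e p.1.1 ⋖ e p.1.2 := (apply_covBy_apply_iff e).2 p.2
  have h' := Fin.covBy_iff.1 h
  exact (Nat.covBy_iff_add_one_eq.1 h').symm

/-- Letter `k` colors the prime interval from position `k` to `k + 1`, so a chain has one element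
more than its word has letters, and `[i, j]` spells the letters `i, ..., j - 1`. -/
theorem intervalRep_eq_wordJoin {C : Type*} [LinearOrder C] [Finite C] {n : ℕ}
    (e : C ≃o Fin (n + 1)) (color : PrimeInterval C → JoinIrr D) (w : List (JoinIrr D))
    (hn : w.length = n)
    (hw : ∀ (p : PrimeInterval C) (h : (e p.1.1 : ℕ) < w.length), color p = w[(e p.1.1 : ℕ)])
    (I : NonemptyInterval C) :
    intervalRep color I = wordJoin ((w.take (e I.snd)).drop (e I.fst)) := by
  refine eq_of_forall_ge_iff fun z => ?_
  rw [intervalRep_le_iff, wordJoin_le_iff]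
  constructor
  · intro H x hx
    obtain ⟨k, hk, rfl⟩ := List.mem_iff_getElem.1 hx
    simp only [List.length_drop, List.length_take, hn] at hk
    have hk' : (e I.fst : ℕ) + k + 1 < n + 1 := by omega
    let p : PrimeInterval C := ⟨(e.symm ⟨e I.fst + k, by omega⟩, e.symm ⟨e I.fst + k + 1, hk'⟩), by
      rw [← apply_covBy_apply_iff e]
      simp only [OrderIso.apply_symm_apply]
      rw [Fin.covBy_iff]
      exact Nat.covBy_iff_add_one_eq.2 rfl⟩
    have h := H p (by
      rw [← e.le_iff_le, Fin.le_def]; simp [p]) (by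
      rw [← e.le_iff_le, Fin.le_def]; simp [p]; omega)
    rw [hw p (by simp [p]; omega)] at h
    simpa [p] using h
  · intro H p h1 h2
    have h3 := PrimeInterval.val_snd_eq e p
    have h1' : (e I.fst : ℕ) ≤ e p.1.1 := Fin.le_def.1 (e.le_iff_le.2 h1)
    have h2' : (e p.1.2 : ℕ) ≤ e I.snd := Fin.le_def.1 (e.le_iff_le.2 h2)
    have h4 : (e p.1.2 : ℕ) < n + 1 := (e p.1.2).2
    have h5 : (e p.1.1 : ℕ) < w.length := by omega
    rw [hw p h5]
    apply H
    refine List.mem_iff_getElem.2 ⟨e p.1.1 - e I.fst, ?_, ?_⟩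
    · simp only [List.length_drop, List.length_take, hn]; omega
    · simp only [List.getElem_drop, List.getElem_take]
      congr 1; omega

theorem representedSet_eq_factorJoins {C : Type*} [LinearOrder C] [Finite C] {n : ℕ}
    (e : C ≃o Fin (n + 1)) (color : PrimeInterval C → JoinIrr D) (w : List (JoinIrr D))
    (hn : w.length = n)
    (hw : ∀ (p : PrimeInterval C) (h : (e p.1.1 : ℕ) < w.length), color p = w[(e p.1.1 : ℕ)]) :
    representedSet color = factorJoins w := by
  ext d
  constructor
  · rintro ⟨I, rfl⟩
    rw [intervalRep_eq_wordJoin e color w hn hw]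
    exact ⟨_, (List.drop_suffix _ _).isInfix.trans (List.take_prefix _ _).isInfix, rfl⟩
  · rintro ⟨u, ⟨s, t, rfl⟩, rfl⟩
    simp only [List.length_append] at hn
    refine ⟨⟨(e.symm ⟨s.length, by omega⟩, e.symm ⟨s.length + u.length, by omega⟩), ?_⟩, ?_⟩
    · simp
    · rw [intervalRep_eq_wordJoin e color _ (by simpa [add_assoc] using hn) hw]
      congr 1
      simp only [OrderIso.apply_symm_apply]
      rw [List.take_append_of_le_length (by simp), List.take_of_length_le (by simp)]
      simp

theorem chainRepresentable_iff {Q : Set D} :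
    ChainRepresentable Q ↔ ∃ w : List (JoinIrr D), (∀ x, x ∈ w) ∧ Q = factorJoins w := by
  constructor
  · rintro ⟨C, _, _, _, color, hs, rfl⟩
    have := Fintype.ofFinite C
    obtain ⟨n, hn⟩ : ∃ n, Fintype.card C = n + 1 :=
      ⟨_, (Nat.succ_pred_eq_of_pos Fintype.card_pos).symm⟩
    let e : C ≃o Fin (n + 1) := (Fintype.orderIsoFinOfCardEq C hn).symm
    let P : Fin n → PrimeInterval C := fun i => ⟨(e.symm i.castSucc, e.symm i.succ), by
      rw [← apply_covBy_apply_iff e]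
      simp only [OrderIso.apply_symm_apply]
      exact Fin.covBy_iff.2 (Nat.covBy_iff_add_one_eq.2 rfl)⟩
    have hP : ∀ (p : PrimeInterval C) (h : (e p.1.1 : ℕ) < n), P ⟨e p.1.1, h⟩ = p := by
      intro p h
      refine Subtype.ext (Prod.ext ?_ ?_)
      · exact e.injective (by simp [P])
      · refine e.injective (Fin.ext ?_)
        rw [PrimeInterval.val_snd_eq e p]
        simp [P]
    refine ⟨List.ofFn fun i => color (P i), fun x => ?_,
      representedSet_eq_factorJoins e color _ (by simp) fun p h => ?_⟩
    · obtain ⟨p, rfl⟩ := hs x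
      have h4 : (e p.1.2 : ℕ) < n + 1 := (e p.1.2).2
      rw [PrimeInterval.val_snd_eq e p] at h4
      exact List.mem_ofFn.2 ⟨⟨e p.1.1, by omega⟩, by rw [hP]⟩
    · rw [List.length_ofFn] at h
      simp [hP p h]
  · rintro ⟨w, hw, rfl⟩
    have hlt : ∀ p : PrimeInterval (Fin (w.length + 1)), (p.1.1 : ℕ) < w.length := by
      intro p
      have h1 := Fin.lt_def.1 p.2.lt
      have h2 := p.1.2.2
      omega
    let color : PrimeInterval (Fin (w.length + 1)) → JoinIrr D := fun p => w[(p.1.1 : ℕ)]'(hlt p)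
    refine ⟨Fin (w.length + 1), inferInstance, inferInstance, inferInstance, color, fun x => ?_,
      (representedSet_eq_factorJoins (OrderIso.refl _) color w rfl fun p h => rfl).symm⟩
    obtain ⟨k, hk, rfl⟩ := List.mem_iff_getElem.1 (hw x)
    exact ⟨⟨(⟨k, by omega⟩, ⟨k + 1, by omega⟩),
      Fin.covBy_iff.2 (Nat.covBy_iff_add_one_eq.2 rfl)⟩, rfl⟩

end Words

/-- Among any three join-irreducible elements two are comparable. -/
def JoinIrrWidthLETwo (D : Type*) [SemilatticeSup D] : Prop :=
  ∀ a b c : D, SupIrred a → SupIrred b → SupIrred c →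
    a ≤ b ∨ b ≤ a ∨ a ≤ c ∨ c ≤ a ∨ b ≤ c ∨ c ≤ b

/-! ### Full representability versus width two and coatoms. -/

section Representability

variable {D : Type*} [DistribLattice D] [BoundedOrder D]

theorem SupIrred.le_sup_iff {D : Type*} [DistribLattice D] {a b c : D} (ha : SupIrred a) : a ≤ b ⊔ c ↔ a ≤ b ∨ a ≤ c :=
  (supPrime_iff_supIrred.2 ha).le_sup

theorem le_of_forall_supIrred_le [Finite D] {d z : D}
    (h : ∀ x, SupIrred x → x ≤ d → x ≤ z) : d ≤ z := by
  obtain ⟨s, rfl, hs⟩ := exists_supIrred_decomposition d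
  exact Finset.sup_le fun x hx => h x (hs hx) (Finset.le_sup (f := id) hx)

theorem joinReducible_iff {a : D} : JoinReducible a ↔ a ≠ ⊥ ∧ ¬SupIrred a := by
  rw [not_supIrred, isMin_iff_eq_bot]
  constructor
  · rintro ⟨b, c, hb, hc, h⟩
    exact ⟨(bot_le.trans_lt hb).ne', .inr ⟨b, c, h, hb, hc⟩⟩
  · rintro ⟨h0, h | ⟨b, c, h, hb, hc⟩⟩
    · exact absurd h h0
    · exact ⟨b, c, hb, hc, h⟩

/-- Suppose adding `x` first reaches `a ⊔ b ⊔ c`. The tail lies below one of the three, so by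
primeness `x` is above the other two; but `x` itself lies below one of the three, making two of them
comparable. Any other value allowed by `hu` is `⊥` or prime. -/
theorem wordJoin_le_of_three_antichain {a b c : D}
    (hab : ¬a ≤ b) (hba : ¬b ≤ a) (hac : ¬a ≤ c) (hca : ¬c ≤ a) (hbc : ¬b ≤ c) (hcb : ¬c ≤ b)
    (ha : SupIrred a) (hb : SupIrred b) (hc : SupIrred c) (u : List (JoinIrr D))
    (hu : factorJoins u ⊆ JPlus D ∪ {a ⊔ b ⊔ c}) (hle : wordJoin u ≤ a ⊔ b ⊔ c) :
    wordJoin u ≤ a ∨ wordJoin u ≤ b ∨ wordJoin u ≤ c := by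
  induction u with
  | nil => simp
  | cons x u ih =>
    have key : a ⊔ b ⊔ c ≤ wordJoin (x :: u) →
        wordJoin (x :: u) ≤ a ∨ wordJoin (x :: u) ≤ b ∨ wordJoin (x :: u) ≤ c := by
      intro h
      exfalso
      rw [wordJoin_cons] at hle h
      simp only [sup_le_iff] at h
      obtain ⟨⟨ha', hb'⟩, hc'⟩ := h
      have hx := le_sup_left.trans hle
      rw [x.2.le_sup_iff, x.2.le_sup_iff] at hx
      rw [ha.le_sup_iff] at ha'
      rw [hb.le_sup_iff] at hb'
      rw [hc.le_sup_iff] at hc'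
      have hih := ih (fun d ⟨v, hv, hd⟩ => hu ⟨v, hv.trans (List.suffix_cons x u).isInfix, hd⟩)
        (le_sup_right.trans hle)
      grind
    rcases hu ⟨_, List.infix_rfl, rfl⟩ with (h | h | h) | h
    · have h' : SupIrred (wordJoin (x :: u)) := h
      rw [h'.le_sup_iff, h'.le_sup_iff, or_assoc] at hle
      exact hle
    · exact .inl (h.trans_le bot_le)
    · exact key (le_top.trans_eq h.symm)
    · exact key h.ge

theorem FullyChainRepresentable.joinIrrWidthLETwo (h : FullyChainRepresentable D) :
    JoinIrrWidthLETwo D := by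
  intro a b c ha hb hc
  by_contra! hcon
  obtain ⟨hab, hba, hac, hca, hbc, hcb⟩ := hcon
  obtain ⟨w, -, hw⟩ := chainRepresentable_iff.1 (h (JPlus D ∪ {a ⊔ b ⊔ c}) Set.subset_union_left)
  obtain ⟨u, hu, hj⟩ : a ⊔ b ⊔ c ∈ factorJoins w := hw ▸ Or.inr rfl
  have := wordJoin_le_of_three_antichain hab hba hac hca hbc hcb ha hb hc u
    (fun d ⟨v, hv, hd⟩ => hw ▸ ⟨v, hv.trans hu, hd⟩) hj.le
  rw [hj] at this
  simp only [sup_le_iff] at this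
  tauto

/-- Extending a factor by one neighboring letter, on either side, gives a join in `Q`, which `hm`
forces to be `m` again. -/
theorem wordJoin_append_eq_of_absorbing {Q : Set D} {m : D}
    (hm : ∀ x : JoinIrr D, m ⊔ x ∈ Q → m ⊔ x = m) {s u t : List (JoinIrr D)}
    (h : factorJoins (s ++ u ++ t) ⊆ Q) (hu : wordJoin u = m) :
    wordJoin (s ++ u ++ t) = m := by
  have hs : ∀ s : List (JoinIrr D), factorJoins (s ++ u) ⊆ Q → wordJoin (s ++ u) = m := by
    intro s
    induction s with
    | nil => exact fun _ => hu
    | cons x s ih =>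
      intro h
      have h1 := ih fun d ⟨v, hv, hd⟩ => h ⟨v, hv.trans (List.suffix_cons _ _).isInfix, hd⟩
      have h2 := h ⟨_, List.infix_rfl, rfl⟩
      rw [List.cons_append, wordJoin_cons, h1, sup_comm] at h2 ⊢
      exact hm x h2
  induction t using List.reverseRecOn with
  | nil => simpa using hs s (by simpa using h)
  | append_singleton t x ih =>
    rw [← List.append_assoc] at h ⊢
    have h1 := ih fun d ⟨v, hv, hd⟩ => h ⟨v, hv.trans (List.prefix_append _ _).isInfix, hd⟩
    have h2 := h ⟨_, List.infix_rfl, rfl⟩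
    rw [wordJoin_append, h1, wordJoin_cons, wordJoin_nil, sup_bot_eq] at h2 ⊢
    exact hm x h2

theorem wordJoin_eq_top [Finite D] {w : List (JoinIrr D)} (hw : ∀ x, x ∈ w) :
    wordJoin w = ⊤ :=
  top_le_iff.1 (le_of_forall_supIrred_le fun x hx _ => le_wordJoin (hw ⟨x, hx⟩))

/-- By modularity `c ⊓ c' ⋖ c`, so the only other possible value is `c`, and a join-reducible coatom
is not in `J⁺(D)`. -/
theorem inf_sup_eq_of_mem_of_le {c c' x : D} (hc : IsCoatom c) (hcr : JoinReducible c)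
    (hc' : IsCoatom c') (hne : c ≠ c') (hx : x ≤ c) (h : c ⊓ c' ⊔ x ∈ JPlus D ∪ {c ⊓ c'}) :
    c ⊓ c' ⊔ x = c ⊓ c' := by
  have hcov : c ⊓ c' ⋖ c := inf_covBy_of_covBy_sup_right (by
    rw [hc.sup_eq_top_of_ne hc' hne]; exact hc'.covBy_top)
  rcases hcov.wcovBy.eq_or_eq le_sup_left (sup_le inf_le_left hx) with h1 | h1
  · exact h1
  · rw [joinReducible_iff] at hcr
    rw [h1] at h ⊢
    rcases h with (h | h | h) | h
    · exact (hcr.2 h).elim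
    · exact (hcr.1 h).elim
    · exact (hc.1 h).elim
    · exact h

theorem FullyChainRepresentable.subsingleton_joinReducible_coatom [Finite D]
    (h : FullyChainRepresentable D) :
    {c : D | IsCoatom c ∧ JoinReducible c}.Subsingleton := by
  rintro c ⟨hc, hcr⟩ c' ⟨hc', hcr'⟩
  by_contra hne
  obtain ⟨w, hall, hw⟩ :=
    chainRepresentable_iff.1 (h (JPlus D ∪ {c ⊓ c'}) Set.subset_union_left)
  obtain ⟨u, ⟨s, t, rfl⟩, hj⟩ : c ⊓ c' ∈ factorJoins w := hw ▸ Or.inr rfl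
  have hm : ∀ x : JoinIrr D, c ⊓ c' ⊔ x ∈ JPlus D ∪ {c ⊓ c'} → c ⊓ c' ⊔ x = c ⊓ c' := by
    intro x hx
    have hle : (x : D) ≤ c ⊔ c' := by rw [hc.sup_eq_top_of_ne hc' hne]; exact le_top
    rcases x.2.le_sup_iff.1 hle with hle | hle
    · exact inf_sup_eq_of_mem_of_le hc hcr hc' hne hle hx
    · rw [inf_comm] at hx ⊢
      exact inf_sup_eq_of_mem_of_le hc' hcr' hc (Ne.symm hne) hle hx
  have h1 := wordJoin_append_eq_of_absorbing hm hw.ge hj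
  rw [wordJoin_eq_top hall] at h1
  exact hc.1 (top_le_iff.1 (h1.trans_le inf_le_left))

/-- If `⊤` is reducible, two elements joining to it lie under two distinct nonzero coatoms, and
these are not both reducible. -/
theorem exists_supIrred_wcovBy_top [Finite D] [Nontrivial D]
    (h : {c : D | IsCoatom c ∧ JoinReducible c}.Subsingleton) :
    ∃ p : D, SupIrred p ∧ p ⩿ ⊤ := by
  by_contra! hcon
  have htop : ¬SupIrred (⊤ : D) := fun ht => hcon _ ht (WCovBy.refl _)
  have hred : ∀ c : D, IsCoatom c → c ≠ ⊥ → IsCoatom c ∧ JoinReducible c := fun c hc h0 =>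
    ⟨hc, joinReducible_iff.2 ⟨h0, fun hs => hcon c hs hc.covBy_top.wcovBy⟩⟩
  obtain ⟨b, c, hb, hc, hbc⟩ := joinReducible_iff.2 ⟨top_ne_bot, htop⟩
  obtain ⟨b', hb', hbb'⟩ := (eq_top_or_exists_le_coatom b).resolve_left hb.ne
  obtain ⟨c', hc', hcc'⟩ := (eq_top_or_exists_le_coatom c).resolve_left hc.ne
  have hsup : b' ⊔ c' = ⊤ := top_le_iff.1 (hbc ▸ sup_le_sup hbb' hcc')
  have hb0 : b' ≠ ⊥ := by rintro rfl; exact hc'.1 (by simpa using hsup)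
  have hc0 : c' ≠ ⊥ := by rintro rfl; exact hb'.1 (by simpa using hsup)
  have := h (hred _ hb' hb0) (hred _ hc' hc0)
  subst this
  exact hb'.1 (by simpa using hsup)

/-- The maximal irreducibles below `y` form an antichain with join `y`, so there are at most two; `a
= b` when there is only one. -/
theorem JoinIrrWidthLETwo.exists_eq_sup [Finite D] (h : JoinIrrWidthLETwo D) {y : D}
    (hy : y ≠ ⊥) : ∃ a b : JoinIrr D, (a : D) ⊔ b = y := by
  obtain ⟨x, hx, hxy⟩ : ∃ x, SupIrred x ∧ x ≤ y := by
    by_contra! hcon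
    exact hy (le_bot_iff.1 (le_of_forall_supIrred_le fun x hx hxy => (hcon x hx hxy).elim))
  obtain ⟨a, -, ⟨ha, hay⟩, hmax⟩ :=
    Finite.exists_le_maximal (p := fun x : D => SupIrred x ∧ x ≤ y) ⟨hx, hxy⟩
  by_cases hall : ∀ z, SupIrred z → z ≤ y → z ≤ a
  · refine ⟨⟨a, ha⟩, ⟨a, ha⟩, ?_⟩
    simpa using le_antisymm hay (le_of_forall_supIrred_le hall)
  · push Not at hall
    obtain ⟨z, hz, hzy, hza⟩ := hall
    obtain ⟨b, hzb, ⟨hb, hby⟩, hbmax⟩ :=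
      Finite.exists_le_maximal (p := fun x : D => SupIrred x ∧ x ≤ y) ⟨hz, hzy⟩
    have hba : ¬b ≤ a := fun hba => hza (hzb.trans hba)
    have hab : ¬a ≤ b := fun hab => hba (hmax ⟨hb, hby⟩ hab)
    refine ⟨⟨a, ha⟩, ⟨b, hb⟩, le_antisymm (sup_le hay hby)
      (le_of_forall_supIrred_le fun x hx hxy => ?_)⟩
    rw [hx.le_sup_iff]
    have h1 : a ≤ x → x ≤ a := hmax ⟨hx, hxy⟩
    have h2 : b ≤ x → x ≤ b := hbmax ⟨hx, hxy⟩
    have h3 := h a b x ha hb hx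
    tauto

/-- A factor that avoids the separators `p` stays inside one block `f y, g y`. -/
theorem factorJoins_flatMap {p : JoinIrr D} {f g : D → JoinIrr D} {L : List D}
    {d : D} (hd : d ∈ factorJoins (p :: L.flatMap fun y => [f y, g y, p])) :
    d = ⊥ ∨ SupIrred d ∨ (p : D) ≤ d ∨ ∃ y ∈ L, d = (f y : D) ⊔ g y := by
  obtain ⟨v, hv, rfl⟩ := hd
  induction L with
  | nil =>
    simp only [List.flatMap_nil, List.infix_cons_iff, List.prefix_cons_iff,
      List.prefix_nil, List.infix_nil] at hv
    rcases hv with (rfl | ⟨t, rfl, rfl⟩) | rfl <;> simp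
  | cons y L ih =>
    rw [List.flatMap_cons, List.cons_append, List.cons_append, List.cons_append,
      List.nil_append, List.infix_cons_iff, List.infix_cons_iff, List.infix_cons_iff] at hv
    rcases hv with hv | hv | hv | hv
    · rcases List.prefix_cons_iff.1 hv with rfl | ⟨t, rfl, -⟩ <;> simp
    · rcases List.prefix_cons_iff.1 hv with rfl | ⟨t, rfl, h1⟩
      · simp
      rcases List.prefix_cons_iff.1 h1 with rfl | ⟨t, rfl, h2⟩
      · exact .inr (.inl (by simpa using (f y).2))
      rcases List.prefix_cons_iff.1 h2 with rfl | ⟨t, rfl, -⟩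
      · exact .inr (.inr (.inr ⟨y, by simp, by simp⟩))
      · exact .inr (.inr (.inl (le_wordJoin (by simp))))
    · rcases List.prefix_cons_iff.1 hv with rfl | ⟨t, rfl, h1⟩
      · simp
      rcases List.prefix_cons_iff.1 h1 with rfl | ⟨t, rfl, -⟩
      · exact .inr (.inl (by simpa using (g y).2))
      · exact .inr (.inr (.inl (le_wordJoin (by simp))))
    · rcases ih hv with h | h | h | ⟨z, hz, h⟩
      · exact .inl h
      · exact .inr (.inl h)
      · exact .inr (.inr (.inl h))
      · exact .inr (.inr (.inr ⟨z, by simp [hz], h⟩))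

theorem JoinIrrWidthLETwo.fullyChainRepresentable [Finite D] (hW : JoinIrrWidthLETwo D)
    (h : {c : D | IsCoatom c ∧ JoinReducible c}.Subsingleton) :
    FullyChainRepresentable D := by
  classical
  intro Q hQ
  rw [chainRepresentable_iff]
  have hbot : ⊥ ∈ Q := hQ (.inr (.inl rfl))
  have htop : ⊤ ∈ Q := hQ (.inr (.inr rfl))
  have hirr : ∀ x, SupIrred x → x ∈ Q := fun x hx => hQ (.inl hx)
  -- The one-element lattice has no letters, so no separator; the empty word serves.
  rcases subsingleton_or_nontrivial D with hD | hD
  · refine ⟨[], fun x => (x.2.ne_bot (Subsingleton.elim _ _)).elim, ?_⟩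
    ext d
    obtain rfl := Subsingleton.elim ⊥ d
    exact ⟨fun _ => ⟨[], List.infix_rfl, rfl⟩, fun _ => hbot⟩
  obtain ⟨p, hp, hpt⟩ := exists_supIrred_wcovBy_top h
  -- No letters join to `⊥`; there `p` is only a filler making `f` and `g` total.
  have hex : ∀ y : D, ∃ a b : JoinIrr D, y ≠ ⊥ → (a : D) ⊔ b = y := by
    intro y
    by_cases hy : y = ⊥
    · exact ⟨⟨p, hp⟩, ⟨p, hp⟩, fun h => (h hy).elim⟩
    · obtain ⟨a, b, hab⟩ := hW.exists_eq_sup hy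
      exact ⟨a, b, fun _ => hab⟩
  choose f g hfg using hex
  let L : List D := (Set.toFinite {y | y ∈ Q ∧ y ≠ ⊥}).toFinset.toList
  have hL : ∀ y, y ∈ L ↔ y ∈ Q ∧ y ≠ ⊥ := by simp [L]
  have hword : ∀ y ∈ Q, y ≠ ⊥ →
      [f y, g y] <:+: (⟨p, hp⟩ : JoinIrr D) :: L.flatMap fun y => [f y, g y, ⟨p, hp⟩] := by
    intro y hy h0
    obtain ⟨s, t, hst⟩ := List.append_of_mem ((hL y).2 ⟨hy, h0⟩)
    refine ⟨⟨p, hp⟩ :: s.flatMap fun y => [f y, g y, ⟨p, hp⟩],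
      ⟨p, hp⟩ :: t.flatMap fun y => [f y, g y, ⟨p, hp⟩], ?_⟩
    rw [hst]
    simp
  refine ⟨⟨p, hp⟩ :: L.flatMap fun y => [f y, g y, ⟨p, hp⟩], fun x => ?_, ?_⟩
  · have hxQ := hword x (hirr x x.2) x.2.ne_bot
    -- Irreducibility of `x = f x ⊔ g x` makes `x` one of these two letters.
    have hx := x.2.2 (hfg x x.2.ne_bot)
    rcases hx with hx | hx
    · exact hxQ.subset (by simp [Subtype.ext_iff, hx])
    · exact hxQ.subset (by simp [Subtype.ext_iff, hx])
  · ext d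
    constructor
    · intro hd
      by_cases h0 : d = ⊥
      · exact ⟨[], List.nil_infix, h0.symm⟩
      · exact ⟨_, hword d hd h0, by simpa using hfg d h0⟩
    · intro hd
      rcases factorJoins_flatMap hd with rfl | hd | hd | ⟨y, hy, rfl⟩
      · exact hbot
      · exact hirr d hd
      · rcases hpt.eq_or_eq hd le_top with rfl | rfl
        · exact hirr _ hp
        · exact htop
      · rw [hfg y ((hL y).1 hy).2]
        exact ((hL y).1 hy).1

end Representability

/-! ### From width two to a planar diagram. -/

section Width

/-- A finite set without three pairwise incomparable elements is the union of two disjoint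
chains. -/
theorem exists_chain_and_chain_sdiff {α : Type*} [PartialOrder α] [DecidableEq α] (s : Finset α)
    (h : ∀ a ∈ s, ∀ b ∈ s, ∀ c ∈ s, a ≤ b ∨ b ≤ a ∨ a ≤ c ∨ c ≤ a ∨ b ≤ c ∨ c ≤ b) :
    ∃ t ⊆ s, (∀ a ∈ t, ∀ b ∈ t, a ≤ b ∨ b ≤ a) ∧
      ∀ a ∈ s, a ∉ t → ∀ b ∈ s, b ∉ t → a ≤ b ∨ b ≤ a := by
  classical
  induction hn : s.card generalizing s with
  | zero =>
    obtain rfl := Finset.card_eq_zero.1 hn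
    exact ⟨∅, by simp⟩
  | succ n ih =>
    -- Galvin's proof of Dilworth's theorem: remove a maximal `a`, split the rest into two chains,
    -- and in each take the largest element incomparable to something. `a` lies above one of these
    -- two; it joins the part of that chain up to there, and what remains is a chain.
    obtain ⟨a, ha⟩ : ∃ a, Maximal (· ∈ s) a := by
      obtain ⟨x, hx⟩ := Finset.card_pos.1 (by omega : 0 < s.card)
      obtain ⟨a, -, ha⟩ := s.exists_le_maximal hx
      exact ⟨a, ha⟩
    have hsub : ∀ x ∈ s.erase a, x ∈ s := fun x hx => Finset.mem_of_mem_erase hx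
    obtain ⟨t, hts, ht, ht'⟩ := ih (s.erase a)
      (fun x hx y hy z hz => h x (hsub x hx) y (hsub y hy) z (hsub z hz))
      (by rw [Finset.card_erase_of_mem ha.1]; omega)
    by_cases hchain : ∀ x ∈ s.erase a, ∀ y ∈ s.erase a, x ≤ y ∨ y ≤ x
    · refine ⟨{a}, by simpa using ha.1, by simp, ?_⟩
      intro x hx hxa y hy hya
      exact hchain x (by simp_all) y (by simp_all)
    -- the part of `s` consisting of `a` and the elements of the chain `u` below a member `x`
    have key : ∀ u ⊆ s.erase a, (∀ x ∈ u, ∀ y ∈ u, x ≤ y ∨ y ≤ x) →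
        (∀ x ∈ s.erase a, x ∉ u → ∀ y ∈ s.erase a, y ∉ u → x ≤ y ∨ y ≤ x) →
        ∀ x ∈ u, x ≤ a → (∀ z ∈ u, ¬z ≤ x → ∀ y ∈ s.erase a, z ≤ y ∨ y ≤ z) →
        ∃ t ⊆ s, (∀ a ∈ t, ∀ b ∈ t, a ≤ b ∨ b ≤ a) ∧
          ∀ a ∈ s, a ∉ t → ∀ b ∈ s, b ∉ t → a ≤ b ∨ b ≤ a := by
      intro u hu hc hc' x hx hxa hz
      refine ⟨insert a (u.filter (· ≤ x)), ?_, ?_, ?_⟩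
      · intro y hy
        rcases Finset.mem_insert.1 hy with rfl | hy
        · exact ha.1
        · exact hsub y (hu (Finset.mem_filter.1 hy).1)
      · intro y hy z hz
        simp only [Finset.mem_insert, Finset.mem_filter] at hy hz
        rcases hy with rfl | hy <;> rcases hz with rfl | hz
        · exact .inl le_rfl
        · exact .inr (hz.2.trans hxa)
        · exact .inl (hy.2.trans hxa)
        · exact hc y hy.1 z hz.1
      · intro y hy hy' z hzs hz'
        simp only [Finset.mem_insert, Finset.mem_filter, not_or, not_and] at hy' hz'
        have hye : y ∈ s.erase a := Finset.mem_erase.2 ⟨hy'.1, hy⟩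
        have hze : z ∈ s.erase a := Finset.mem_erase.2 ⟨hz'.1, hzs⟩
        by_cases hyu : y ∈ u
        · exact hz y hyu (hy'.2 hyu) z hze
        by_cases hzu : z ∈ u
        · exact (hz z hzu (hz'.2 hzu) y hye).symm
        · exact hc' y hye hyu z hze hzu
    -- the largest member of a chain that is incomparable to something
    have top : ∀ u ⊆ s.erase a, (∀ x ∈ u, ∀ y ∈ u, x ≤ y ∨ y ≤ x) →
        (∃ x ∈ u, ∃ y ∈ s.erase a, ¬x ≤ y ∧ ¬y ≤ x) →
        ∃ x ∈ u, (∃ y ∈ s.erase a, ¬x ≤ y ∧ ¬y ≤ x) ∧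
          ∀ z ∈ u, (∃ y ∈ s.erase a, ¬z ≤ y ∧ ¬y ≤ z) → z ≤ x := by
      rintro u hu hc ⟨x, hx, hxy⟩
      obtain ⟨m, -, hm⟩ := (u.filter fun x => ∃ y ∈ s.erase a, ¬x ≤ y ∧ ¬y ≤ x).exists_le_maximal
        (Finset.mem_filter.2 ⟨hx, hxy⟩)
      have hmu := Finset.mem_filter.1 hm.1
      refine ⟨m, hmu.1, hmu.2, fun z hz hzy => ?_⟩
      rcases hc z hz m hmu.1 with h | h
      · exact h
      · exact hm.2 (Finset.mem_filter.2 ⟨hz, hzy⟩) h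
    have hcv : ∀ x ∈ s.erase a \ t, ∀ y ∈ s.erase a \ t, x ≤ y ∨ y ≤ x := fun x hx y hy =>
      ht' x (Finset.mem_sdiff.1 hx).1 (Finset.mem_sdiff.1 hx).2 y (Finset.mem_sdiff.1 hy).1
        (Finset.mem_sdiff.1 hy).2
    push Not at hchain
    obtain ⟨x, hx, y, hy, hxy, hyx⟩ := hchain
    have hmix : ∃ x ∈ t, ∃ y ∈ s.erase a \ t, ¬x ≤ y ∧ ¬y ≤ x := by
      by_cases hxt : x ∈ t <;> by_cases hyt : y ∈ t
      · exact absurd (ht x hxt y hyt) (by tauto)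
      · exact ⟨x, hxt, y, Finset.mem_sdiff.2 ⟨hy, hyt⟩, hxy, hyx⟩
      · exact ⟨y, hyt, x, Finset.mem_sdiff.2 ⟨hx, hxt⟩, hyx, hxy⟩
      · exact absurd (ht' x hx hxt y hy hyt) (by tauto)
    obtain ⟨x, hx, y, hy, hxy, hyx⟩ := hmix
    have hsd : s.erase a \ t ⊆ s.erase a := Finset.sdiff_subset
    obtain ⟨p, hp, ⟨p', hp', hpp', hp'p⟩, hpmax⟩ := top t hts ht ⟨x, hx, y, hsd hy, hxy, hyx⟩
    obtain ⟨q, hq, ⟨q', hq', hqq', hq'q⟩, hqmax⟩ :=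
      top _ hsd hcv ⟨y, hy, x, hts hx, hyx, hxy⟩
    have hp't : p' ∈ s.erase a \ t := Finset.mem_sdiff.2 ⟨hp', fun hm => by
      have := ht p hp p' hm; tauto⟩
    have hq't : q' ∈ t := by
      by_contra hm
      have := hcv q hq q' (Finset.mem_sdiff.2 ⟨hq', hm⟩)
      tauto
    -- The partners `p'`, `q'` lie in the opposite chains, hence below `q`, `p`. So if `p` and `q`
    -- were comparable, one of them would be comparable to its own partner.
    have hp'q : p' ≤ q := hqmax p' hp't ⟨p, hts hp, hp'p, hpp'⟩
    have hq'p : q' ≤ p := hpmax q' hq't ⟨q, hsd hq, hq'q, hqq'⟩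
    have hpq : ¬p ≤ q := fun hle => hq'q (hq'p.trans hle)
    have hqp : ¬q ≤ p := fun hle => hp'p (hp'q.trans hle)
    have hmaxp : ∀ z ∈ t, ¬z ≤ p → ∀ y ∈ s.erase a, z ≤ y ∨ y ≤ z := by
      intro z hz hzp y hy
      by_contra! hcon
      exact hzp (hpmax z hz ⟨y, hy, hcon.1, hcon.2⟩)
    have hmaxq : ∀ z ∈ s.erase a \ t, ¬z ≤ q → ∀ y ∈ s.erase a, z ≤ y ∨ y ≤ z := by
      intro z hz hzp y hy
      by_contra! hcon
      exact hzp (hqmax z hz ⟨y, hy, hcon.1, hcon.2⟩)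
    have hps := hsub p (hts hp)
    have hqs := hsub q (hsd hq)
    have hcomp : p ≤ a ∨ q ≤ a := by
      have h1 : a ≤ p → p ≤ a := ha.2 hps
      have h2 : a ≤ q → q ≤ a := ha.2 hqs
      have h3 := h a ha.1 p hps q hqs
      tauto
    rcases hcomp with hpa | hqa
    · exact key t hts ht ht' p hp hpa hmaxp
    · refine key _ hsd hcv ?_ q hq hqa hmaxq
      intro x hx hx' y hy hy'
      simp only [Finset.mem_sdiff, not_and, not_not] at hx' hy'
      exact ht x (hx' hx) y (hy' hy)

/-- Covering pairs of a finite distributive lattice differ in exactly one join-irreducible. -/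
theorem CovBy.supIrred_eq {D : Type*} [DistribLattice D] {d e x y : D} (h : d ⋖ e)
    (hx : SupIrred x) (hy : SupIrred y) (hxe : x ≤ e) (hxd : ¬x ≤ d) (hye : y ≤ e)
    (hyd : ¬y ≤ d) : x = y := by
  have aux : ∀ x y : D, SupIrred x → x ≤ e → ¬x ≤ d → y ≤ e → ¬y ≤ d → x ≤ y := by
    intro x y hx hxe hxd hye hyd
    have h1 : y ⊔ d = e := (h.wcovBy.eq_or_eq le_sup_right (sup_le hye h.le)).resolve_left
      fun h' => hyd (le_sup_left.trans_eq h')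
    exact (hx.le_sup_iff.1 (hxe.trans_eq h1.symm)).resolve_right hxd
  exact le_antisymm (aux x y hx hxe hxd hye hyd) (aux y x hy hye hyd hxe hxd)

/-- An injective map to the integer grid that sends covering pairs to unit steps yields a planar
diagram. -/
theorem isPlanarDiagram_of_grid {D : Type*} [PartialOrder D] (i j : D → ℕ)
    (hinj : ∀ a b, i a = i b → j a = j b → a = b)
    (hmono : ∀ a b, a < b → i a + j a < i b + j b)
    (hcov : ∀ a b, a ⋖ b → (i b = i a + 1 ∧ j b = j a) ∨ (i b = i a ∧ j b = j a + 1)) :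
    IsPlanarDiagram fun d : D => ((j d : ℝ) - i d, (i d : ℝ) + j d) := by
  -- The diagram is the grid turned by 45 degrees (and scaled), so that height is `i + j`.
  have hpos : ∀ a b : D, (((j a : ℝ) - i a, (i a : ℝ) + j a) : ℝ × ℝ) =
      ((j b : ℝ) - i b, (i b : ℝ) + j b) → a = b := by
    intro a b h
    rw [Prod.mk.injEq] at h
    exact hinj a b (by exact_mod_cast (by linarith [h.1, h.2] : (i a : ℝ) = i b))
      (by exact_mod_cast (by linarith [h.1, h.2] : (j a : ℝ) = j b))
  -- points of an edge in grid coordinates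
  have hseg : ∀ a b : D, a ⋖ b → ∀ P : ℝ × ℝ, P ∈ segment ℝ
      (((j a : ℝ) - i a, (i a : ℝ) + j a) : ℝ × ℝ) ((j b : ℝ) - i b, (i b : ℝ) + j b) →
      ∃ t : ℝ, 0 ≤ t ∧ t ≤ 1 ∧
        ((i b = i a + 1 ∧ j b = j a ∧ P = (j a - (i a + t), i a + t + j a)) ∨
         (i b = i a ∧ j b = j a + 1 ∧ P = (j a + t - i a, i a + (j a + t)))) := by
    intro a b hab P hP
    rw [segment_eq_image] at hP
    obtain ⟨t, ⟨h0, h1⟩, rfl⟩ := hP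
    refine ⟨t, h0, h1, ?_⟩
    rcases hcov a b hab with ⟨hi, hj⟩ | ⟨hi, hj⟩
    · refine .inl ⟨hi, hj, ?_⟩
      simp only [hi, hj, Prod.smul_mk, Prod.mk_add_mk, smul_eq_mul, Prod.mk.injEq]
      push_cast
      constructor <;> ring
    · refine .inr ⟨hi, hj, ?_⟩
      simp only [hi, hj, Prod.smul_mk, Prod.mk_add_mk, smul_eq_mul, Prod.mk.injEq]
      push_cast
      constructor <;> ring
  have hunit : ∀ (t : ℝ) (m n : ℕ), 0 ≤ t → t ≤ 1 → (m : ℝ) + t = n →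
      (t = 0 ∧ n = m) ∨ (t = 1 ∧ n = m + 1) := by
    intro t m n h0 h1 h
    have h2 : m ≤ n := by exact_mod_cast (by linarith : (m : ℝ) ≤ n)
    have h3 : n ≤ m + 1 := by exact_mod_cast (by push_cast; linarith : (n : ℝ) ≤ (m + 1 : ℕ))
    rcases (by omega : n = m ∨ n = m + 1) with rfl | rfl
    · exact .inl ⟨by linarith, rfl⟩
    · exact .inr ⟨by push_cast at h; linarith, rfl⟩
  -- a grid point on an edge is an endpoint
  have hgrid : ∀ a b : D, a ⋖ b → ∀ m n : ℕ, (((n : ℝ) - m, (m : ℝ) + n) : ℝ × ℝ) ∈ segment ℝ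
      (((j a : ℝ) - i a, (i a : ℝ) + j a) : ℝ × ℝ) ((j b : ℝ) - i b, (i b : ℝ) + j b) →
      (m = i a ∧ n = j a) ∨ (m = i b ∧ n = j b) := by
    intro a b hab m n hP
    obtain ⟨t, h0, h1, ⟨hi, hj, h⟩ | ⟨hi, hj, h⟩⟩ := hseg a b hab _ hP
    · rw [Prod.mk.injEq] at h
      have hn : n = j a := by exact_mod_cast (by linarith [h.1, h.2] : (n : ℝ) = j a)
      rcases hunit t (i a) m h0 h1 (by linarith [h.1, h.2]) with h | h <;> omega
    · rw [Prod.mk.injEq] at h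
      have hn : m = i a := by exact_mod_cast (by linarith [h.1, h.2] : (m : ℝ) = i a)
      rcases hunit t (j a) n h0 h1 (by linarith [h.1, h.2]) with h | h <;> omega
  refine ⟨fun a b h => hpos a b h, fun a b h => ?_, fun a b v hab hv => ?_, ?_⟩
  · change (i a : ℝ) + j a < i b + j b
    exact_mod_cast hmono a b h
  · rcases hgrid a b hab _ _ hv with h | h
    · exact .inl (hinj _ _ h.1 h.2)
    · exact .inr (hinj _ _ h.1 h.2)
  · intro a b c d hab hcd hne P hP hP'
    have hfin : ∀ m n : ℕ, P = ((n : ℝ) - m, (m : ℝ) + n) → ∃ v : D, (v = a ∨ v = b) ∧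
        (v = c ∨ v = d) ∧ P = ((j v : ℝ) - i v, (i v : ℝ) + j v) := by
      rintro m n rfl
      have h2 : ∀ v, m = i v ∧ n = j v → v = c ∨ v = d := by
        rintro v ⟨rfl, rfl⟩
        exact (hgrid c d hcd _ _ hP').imp (fun h => hinj _ _ h.1 h.2) fun h => hinj _ _ h.1 h.2
      rcases hgrid a b hab m n hP with h | h
      · exact ⟨a, .inl rfl, h2 a h, by rw [h.1, h.2]⟩
      · exact ⟨b, .inr rfl, h2 b h, by rw [h.1, h.2]⟩
    -- Two unit edges on one grid line coincide or meet only at a grid point; perpendicular edges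
    -- always meet at a grid point, each having one integer coordinate fixed.
    have hpar : ∀ (t s : ℝ) (m n : ℕ), 0 ≤ t → t ≤ 1 → 0 ≤ s → s ≤ 1 →
        (m : ℝ) + t = n + s → m = n ∨ ∃ k : ℕ, (m : ℝ) + t = k := by
      intro t s m n h0 h1 h0' h1' h
      have h2 : m ≤ n + 1 := by exact_mod_cast (by push_cast; linarith : (m : ℝ) ≤ (n + 1 : ℕ))
      have h3 : n ≤ m + 1 := by exact_mod_cast (by push_cast; linarith : (n : ℝ) ≤ (m + 1 : ℕ))
      rcases (by omega : m = n ∨ n = m + 1 ∨ m = n + 1) with h4 | rfl | rfl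
      · exact .inl h4
      · exact .inr ⟨m + 1, by push_cast at h ⊢; linarith⟩
      · exact .inr ⟨n + 1, by push_cast at h ⊢; linarith⟩
    obtain ⟨t, h0, h1, ht⟩ := hseg a b hab P hP
    obtain ⟨s, h0', h1', hs⟩ := hseg c d hcd P hP'
    rcases ht with ⟨hi, hj, ht⟩ | ⟨hi, hj, ht⟩ <;> rcases hs with ⟨hi', hj', hs⟩ | ⟨hi', hj', hs⟩ <;>
      have hE := ht.symm.trans hs <;> rw [Prod.mk.injEq] at hE
    · have hjj : j a = j c := by exact_mod_cast (by linarith [hE.1, hE.2] : (j a : ℝ) = j c)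
      rcases hpar t s (i a) (i c) h0 h1 h0' h1' (by linarith [hE.1, hE.2]) with h | ⟨k, hk⟩
      · exact absurd (Prod.ext (hinj a c h hjj) (hinj b d (by omega) (by omega))) hne
      · exact hfin k (j a) (by rw [ht, hk])
    · exact hfin (i c) (j a) (by
        rw [ht, show (i a : ℝ) + t = i c by linarith [hE.1, hE.2]])
    · exact hfin (i a) (j c) (by
        rw [ht, show (j a : ℝ) + t = j c by linarith [hE.1, hE.2]])
    · have hii : i a = i c := by exact_mod_cast (by linarith [hE.1, hE.2] : (i a : ℝ) = i c)
      rcases hpar t s (j a) (j c) h0 h1 h0' h1' (by linarith [hE.1, hE.2]) with h | ⟨k, hk⟩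
      · exact absurd (Prod.ext (hinj a c hii h) (hinj b d (by omega) (by omega))) hne
      · exact hfin (i a) k (by rw [ht, hk])

/-- The coordinates count the irreducibles below `d` in each of two chains. A cover adds exactly one
irreducible, hence is a unit step. -/
theorem JoinIrrWidthLETwo.isPlanarOrder {D : Type*} [DistribLattice D] [BoundedOrder D] [Finite D]
    (hW : JoinIrrWidthLETwo D) : IsPlanarOrder D := by
  classical
  have := Fintype.ofFinite D
  let s : Finset D := Finset.univ.filter SupIrred
  have hs : ∀ x, x ∈ s ↔ SupIrred x := by simp [s]
  obtain ⟨t, hts, ht, ht'⟩ := exists_chain_and_chain_sdiff s fun a ha b hb c hc =>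
    hW a b c ((hs a).1 ha) ((hs b).1 hb) ((hs c).1 hc)
  let r := s \ t
  have hr : ∀ x ∈ r, ∀ y ∈ r, x ≤ y ∨ y ≤ x := fun x hx y hy =>
    ht' x (Finset.mem_sdiff.1 hx).1 (Finset.mem_sdiff.1 hx).2 y (Finset.mem_sdiff.1 hy).1
      (Finset.mem_sdiff.1 hy).2
  have hrs : r ⊆ s := Finset.sdiff_subset
  have hmono : ∀ (u : Finset D) (a b : D), a ≤ b → u.filter (· ≤ a) ⊆ u.filter (· ≤ b) :=
    fun u a b hab => Finset.monotone_filter_right u fun x _ hx => hx.trans hab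
  -- counting the members of a chain below an element determines them
  have hdet : ∀ u : Finset D, (∀ x ∈ u, ∀ y ∈ u, x ≤ y ∨ y ≤ x) → ∀ a b : D,
      (u.filter (· ≤ a)).card = (u.filter (· ≤ b)).card → ∀ x ∈ u, x ≤ a → x ≤ b := by
    intro u hu a b hab x hx hxa
    by_contra hxb
    have hsub : u.filter (· ≤ b) ⊆ u.filter (· ≤ a) := by
      intro y hy
      rw [Finset.mem_filter] at hy ⊢
      refine ⟨hy.1, ((hu x hx y hy.1).resolve_left fun h => hxb (h.trans hy.2)).trans hxa⟩
    have h1 := Finset.eq_of_subset_of_card_le hsub hab.le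
    have h2 : x ∈ u.filter (· ≤ b) := h1 ▸ Finset.mem_filter.2 ⟨hx, hxa⟩
    exact hxb (Finset.mem_filter.1 h2).2
  let i : D → ℕ := fun d => (t.filter (· ≤ d)).card
  let j : D → ℕ := fun d => (r.filter (· ≤ d)).card
  have hle : ∀ a b, i a = i b → j a = j b → a ≤ b := by
    intro a b hi hj
    refine le_of_forall_supIrred_le fun x hx hxa => ?_
    by_cases hxt : x ∈ t
    · exact hdet t ht a b hi x hxt hxa
    · exact hdet r hr a b hj x (Finset.mem_sdiff.2 ⟨(hs x).2 hx, hxt⟩) hxa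
  have hinj : ∀ a b, i a = i b → j a = j b → a = b := fun a b hi hj =>
    le_antisymm (hle a b hi hj) (hle b a hi.symm hj.symm)
  have hlt : ∀ a b, a < b → i a + j a < i b + j b := by
    intro a b hab
    have h1 : i a ≤ i b := Finset.card_le_card (hmono t a b hab.le)
    have h2 : j a ≤ j b := Finset.card_le_card (hmono r a b hab.le)
    by_contra hcon
    exact hab.ne (hinj a b (by omega) (by omega))
  -- a step up adds at most one member of a set of join-irreducibles
  have hstep : ∀ (u : Finset D), u ⊆ s → ∀ a b x : D, a ⋖ b → SupIrred x → x ≤ b → ¬x ≤ a →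
      (u.filter (· ≤ b)).card = (u.filter (· ≤ a)).card + if x ∈ u then 1 else 0 := by
    intro u hu a b x hab hx hxb hxa
    have hy : ∀ y ∈ u, y ≤ b → ¬y ≤ a → y = x := fun y hy hyb hya =>
      hab.supIrred_eq ((hs y).1 (hu hy)) hx hyb hya hxb hxa
    split_ifs with hxu
    · rw [← Finset.card_insert_of_notMem (a := x) (by simp [hxa])]
      congr 1
      ext y
      simp only [Finset.mem_filter, Finset.mem_insert]
      constructor
      · rintro ⟨h1, h2⟩
        by_cases h3 : y ≤ a
        · exact .inr ⟨h1, h3⟩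
        · exact .inl (hy y h1 h2 h3)
      · rintro (rfl | ⟨h1, h2⟩)
        · exact ⟨hxu, hxb⟩
        · exact ⟨h1, h2.trans hab.le⟩
    · rw [add_zero]
      congr 1
      refine (Finset.Subset.antisymm (hmono u a b hab.le) fun y hyb => ?_).symm
      rw [Finset.mem_filter] at hyb ⊢
      refine ⟨hyb.1, ?_⟩
      by_contra hya
      exact hxu (hy y hyb.1 hyb.2 hya ▸ hyb.1)
  refine ⟨inferInstance, _, isPlanarDiagram_of_grid i j hinj hlt fun a b hab => ?_⟩
  obtain ⟨x, hx, hxb, hxa⟩ : ∃ x, SupIrred x ∧ x ≤ b ∧ ¬x ≤ a := by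
    by_contra! hcon
    exact hab.lt.not_ge (le_of_forall_supIrred_le hcon)
  have h1 : i b = i a + _ := hstep t hts a b x hab hx hxb hxa
  have h2 : j b = j a + _ := hstep r hrs a b x hab hx hxb hxa
  by_cases hxt : x ∈ t
  · rw [if_pos hxt] at h1
    rw [if_neg fun h => (Finset.mem_sdiff.1 h).2 hxt] at h2
    exact .inl ⟨h1, h2⟩
  · rw [if_neg hxt] at h1
    rw [if_pos (Finset.mem_sdiff.2 ⟨(hs x).2 hx, hxt⟩)] at h2
    exact .inr ⟨h1, h2⟩

end Width

/-! ### From a planar diagram to width two. -/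

section Planar

/-- The inverse slope of the line through two points of the plane. -/
noncomputable def invSlope (P Q : ℝ × ℝ) : ℝ := (Q.1 - P.1) / (Q.2 - P.2)

/-- The first coordinate at height `y` of the line through two points of the plane. -/
noncomputable def lineAt (P Q : ℝ × ℝ) (y : ℝ) : ℝ := P.1 + (y - P.2) * invSlope P Q

theorem continuous_lineAt (P Q : ℝ × ℝ) : Continuous (lineAt P Q) := by
  unfold lineAt; fun_prop

theorem lineAt_left (P Q : ℝ × ℝ) : lineAt P Q P.2 = P.1 := by simp [lineAt]

theorem lineAt_right {P Q : ℝ × ℝ} (h : P.2 < Q.2) : lineAt P Q Q.2 = Q.1 := by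
  rw [lineAt, invSlope, mul_div_cancel₀ _ (sub_pos.2 h).ne']; ring

theorem lineAt_mem_segment {P Q : ℝ × ℝ} (h : P.2 < Q.2) {y : ℝ} (h1 : P.2 ≤ y) (h2 : y ≤ Q.2) :
    (lineAt P Q y, y) ∈ segment ℝ P Q := by
  have h0 : 0 < Q.2 - P.2 := sub_pos.2 h
  rw [segment_eq_image']
  refine ⟨(y - P.2) / (Q.2 - P.2), ⟨div_nonneg (sub_nonneg.2 h1) h0.le, ?_⟩, ?_⟩
  · rw [div_le_one h0]; linarith
  · refine Prod.ext ?_ ?_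
    · simp only [lineAt, invSlope, Prod.fst_add, Prod.smul_fst, Prod.fst_sub, smul_eq_mul]
      ring
    · simp only [Prod.snd_add, Prod.smul_snd, Prod.snd_sub, smul_eq_mul]
      rw [div_mul_cancel₀ _ h0.ne']; ring

/-- The function equal to `f` up to `t` and to `g` beyond. -/
noncomputable def glueAt (t : ℝ) (f g : ℝ → ℝ) (y : ℝ) : ℝ := if y ≤ t then f y else g y

theorem continuous_glueAt {t : ℝ} {f g : ℝ → ℝ} (hf : Continuous f) (hg : Continuous g)
    (h : f t = g t) : Continuous (glueAt t f g) :=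
  hf.if_le hg continuous_id continuous_const (by rintro y rfl; exact h)

theorem glueAt_of_le {t y : ℝ} {f g : ℝ → ℝ} (h : y ≤ t) : glueAt t f g y = f y := if_pos h

theorem glueAt_of_lt {t y : ℝ} {f g : ℝ → ℝ} (h : t < y) : glueAt t f g y = g y :=
  if_neg h.not_ge

theorem lt_of_continuous_of_ne {f g : ℝ → ℝ} (hf : Continuous f) (hg : Continuous g) {s t : ℝ}
    (hst : s ≤ t) (hs : f s < g s) (hne : ∀ y, s ≤ y → y ≤ t → f y ≠ g y) : f t < g t := by
  by_contra! ht
  obtain ⟨y, hy, h0⟩ := intermediate_value_Icc' hst (hg.sub hf).continuousOn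
    (show (0 : ℝ) ∈ Set.Icc ((g - f) t) ((g - f) s) from
      ⟨by simpa using ht, by simpa using hs.le⟩)
  exact hne y hy.1 hy.2 (sub_eq_zero.1 h0).symm

namespace IsPlanarDiagram

variable {D : Type*}

/-- Two edges leaving `x` in the same direction would put the lower of their upper ends on the other
edge. -/
theorem invSlope_ne [PartialOrder D] {pos : D → ℝ × ℝ} (h : IsPlanarDiagram pos) {x a b : D}
    (ha : x ⋖ a) (hb : x ⋖ b) (hab : a ≠ b) :
    invSlope (pos x) (pos a) ≠ invSlope (pos x) (pos b) := by
  wlog hle : (pos a).2 ≤ (pos b).2 generalizing a b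
  · exact (this hb ha hab.symm (le_of_not_ge hle)).symm
  intro hs
  have hxa := h.upward _ _ ha.lt
  have hxb := h.upward _ _ hb.lt
  have hm := lineAt_mem_segment hxb hxa.le hle
  have he : lineAt (pos x) (pos b) (pos a).2 = (pos a).1 := by
    rw [← lineAt_right hxa, lineAt, lineAt, hs]
  rw [he] at hm
  rcases h.vertex_edge x b a hb hm with h' | h'
  · exact ha.lt.ne' h'
  · exact hab h'

/-- Two edges, one inside the ideal of `d` and the other starting at `x` or in the filter of an
element `b` outside this ideal, meet at most at `x`. -/
theorem eq_of_mem_segments [PartialOrder D] {pos : D → ℝ × ℝ} (h : IsPlanarDiagram pos)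
    {x b d u u' v v' : D} (hbd : ¬b ≤ d) (hu : u ⋖ u') (hud : u' ≤ d) (hv : v ⋖ v')
    (hbv : b ≤ v') (hxv : v = x ∨ b ≤ v) {P : ℝ × ℝ} (hP : P ∈ segment ℝ (pos u) (pos u'))
    (hP' : P ∈ segment ℝ (pos v) (pos v')) : P = pos x := by
  obtain ⟨w, hw, hw', rfl⟩ := h.edge_edge u u' v v' hu hv (by
    intro he
    obtain rfl := (Prod.mk.inj he).2
    exact hbd (hbv.trans hud)) P hP hP'
  have hwd : w ≤ d := by
    rcases hw with rfl | rfl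
    · exact hu.le.trans hud
    · exact hud
  rcases hw' with rfl | rfl
  · rcases hxv with rfl | hxv
    · rfl
    · exact absurd (hxv.trans hwd) hbd
  · exact absurd (hbv.trans hwd) hbd

/-- The edge from `x` to `b` cannot leave between the edges to `a` and `c` if `a` and `c` have a
common cover `d` not above `b` and there is a path from `b` up to an element above `d`. -/
theorem not_invSlope_between [PartialOrder D] {pos : D → ℝ × ℝ} (h : IsPlanarDiagram pos)
    {x a b c d e f : D} (xa : x ⋖ a) (xb : x ⋖ b) (xc : x ⋖ c) (ad : a ⋖ d) (cd : c ⋖ d)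
    (be : b ⋖ e) (ef : e ⋖ f) (hbd : ¬b ≤ d) (hdf : d < f)
    (h1 : invSlope (pos x) (pos a) < invSlope (pos x) (pos b))
    (h2 : invSlope (pos x) (pos b) < invSlope (pos x) (pos c)) : False := by
  -- Paths are functions of height: `M` follows `x, b, e, f`, and `S a`, `S c` follow the two sides
  -- of the quadrilateral `x, a, d, c`.
  let M : ℝ → ℝ := glueAt (pos b).2 (lineAt (pos x) (pos b))
    (glueAt (pos e).2 (lineAt (pos b) (pos e)) (lineAt (pos e) (pos f)))
  let S : D → ℝ → ℝ := fun a => glueAt (pos a).2 (lineAt (pos x) (pos a)) (lineAt (pos a) (pos d))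
  have hxb := h.upward _ _ xb.lt
  have hbe := h.upward _ _ be.lt
  have hef := h.upward _ _ ef.lt
  have hM : Continuous M := by
    refine continuous_glueAt (continuous_lineAt _ _) (continuous_glueAt (continuous_lineAt _ _)
      (continuous_lineAt _ _) ?_) ?_
    · rw [lineAt_right hbe, lineAt_left]
    · rw [lineAt_right hxb, glueAt_of_le hbe.le, lineAt_left]
  have hS : ∀ a, x ⋖ a → Continuous (S a) := fun a xa => by
    refine continuous_glueAt (continuous_lineAt _ _) (continuous_lineAt _ _) ?_
    rw [lineAt_right (h.upward _ _ xa.lt), lineAt_left]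
  have hSd : ∀ a, a ⋖ d → S a (pos d).2 = (pos d).1 := fun a ad => by
    have had := h.upward _ _ ad.lt
    rw [show S a (pos d).2 = _ from glueAt_of_lt had, lineAt_right had]
  have hMmem : ∀ y, (pos x).2 < y → y ≤ (pos d).2 → ∃ v v', v ⋖ v' ∧ b ≤ v' ∧ (v = x ∨ b ≤ v) ∧
      (M y, y) ∈ segment ℝ (pos v) (pos v') := by
    intro y hy hyd
    rcases le_or_gt y (pos b).2 with hyb | hyb
    · refine ⟨x, b, xb, le_rfl, .inl rfl, ?_⟩
      rw [show M y = _ from glueAt_of_le hyb]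
      exact lineAt_mem_segment hxb hy.le hyb
    rw [show M y = _ from glueAt_of_lt hyb]
    rcases le_or_gt y (pos e).2 with hye | hye
    · refine ⟨b, e, be, be.le, .inr le_rfl, ?_⟩
      rw [glueAt_of_le hye]
      exact lineAt_mem_segment hbe hyb.le hye
    · refine ⟨e, f, ef, be.le.trans ef.le, .inr be.le, ?_⟩
      rw [glueAt_of_lt hye]
      exact lineAt_mem_segment hef hye.le (hyd.trans (h.upward _ _ hdf).le)
  have hne : ∀ a, x ⋖ a → a ⋖ d → ∀ y, (pos x).2 < y → y ≤ (pos d).2 → S a y ≠ M y := by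
    intro a xa ad y hy hyd heq
    have hSmem : ∃ u u', u ⋖ u' ∧ u' ≤ d ∧ (S a y, y) ∈ segment ℝ (pos u) (pos u') := by
      rcases le_or_gt y (pos a).2 with hya | hya
      · refine ⟨x, a, xa, ad.le, ?_⟩
        rw [show S a y = _ from glueAt_of_le hya]
        exact lineAt_mem_segment (h.upward _ _ xa.lt) hy.le hya
      · refine ⟨a, d, ad, le_rfl, ?_⟩
        rw [show S a y = _ from glueAt_of_lt hya]
        exact lineAt_mem_segment (h.upward _ _ ad.lt) hya.le hyd
    obtain ⟨u, u', hu, hud, hP⟩ := hSmem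
    obtain ⟨v, v', hv, hbv, hxv, hP'⟩ := hMmem y hy hyd
    rw [← heq] at hP'
    have := h.eq_of_mem_segments hbd hu hud hv hbv hxv hP hP'
    exact hy.ne' (congrArg Prod.snd this)
  -- At height `s` all three paths are on their first edges, so the slopes order them. Meeting only
  -- at `x`, they keep this order up to `d`, where `S a` and `S c` coincide and leave no room for
  -- `M`.
  obtain ⟨s, hs, hsa, hsb, hsc⟩ : ∃ s, (pos x).2 < s ∧ s ≤ (pos a).2 ∧ s ≤ (pos b).2 ∧
      s ≤ (pos c).2 :=
    ⟨min (pos a).2 (min (pos b).2 (pos c).2),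
      lt_min (h.upward _ _ xa.lt) (lt_min hxb (h.upward _ _ xc.lt)), by simp, by simp, by simp⟩
  have hsd : s ≤ (pos d).2 := hsa.trans (h.upward _ _ ad.lt).le
  have hMs : M s = lineAt (pos x) (pos b) s := glueAt_of_le hsb
  have hleft : S a (pos d).2 < M (pos d).2 := by
    refine lt_of_continuous_of_ne (hS a xa) hM hsd ?_ fun y hy hyd =>
      hne a xa ad y (hs.trans_le hy) hyd
    rw [hMs, show S a s = _ from glueAt_of_le hsa, lineAt, lineAt]
    have := mul_lt_mul_of_pos_left h1 (sub_pos.2 hs)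
    linarith
  have hright : M (pos d).2 < S c (pos d).2 := by
    refine lt_of_continuous_of_ne hM (hS c xc) hsd ?_ fun y hy hyd =>
      (hne c xc cd y (hs.trans_le hy) hyd).symm
    rw [hMs, show S c s = _ from glueAt_of_le hsc, lineAt, lineAt]
    have := mul_lt_mul_of_pos_left h2 (sub_pos.2 hs)
    linarith
  rw [hSd a ad] at hleft
  rw [hSd c cd] at hright
  exact lt_asymm hleft hright

/-- By distributivity three covers of `x` generate a cube. With `b` the middle one by slope, the
path `x, b, a ⊔ b, a ⊔ b ⊔ c` is trapped between the two sides from `x` to `a ⊔ c`. -/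
theorem not_three_covers [DistribLattice D] {pos : D → ℝ × ℝ} (h : IsPlanarDiagram pos)
    {x a b c : D} (xa : x ⋖ a) (xb : x ⋖ b) (xc : x ⋖ c) (hab : a ≠ b) (hac : a ≠ c)
    (hbc : b ≠ c) : False := by
  have hinf : ∀ {a b : D}, x ⋖ a → x ⋖ b → a ≠ b → a ⊓ b = x := by
    intro a b xa xb hab
    refine (xa.wcovBy.eq_or_eq (le_inf xa.le xb.le) inf_le_left).resolve_right fun he => ?_
    rcases xb.wcovBy.eq_or_eq xa.le (inf_eq_left.1 he) with h1 | h1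
    · exact xa.lt.ne' h1
    · exact hab h1
  have key : ∀ {a b c : D}, x ⋖ a → x ⋖ b → x ⋖ c → a ≠ b → a ≠ c → b ≠ c →
      invSlope (pos x) (pos a) < invSlope (pos x) (pos b) →
      invSlope (pos x) (pos b) < invSlope (pos x) (pos c) → False := by
    intro a b c xa xb xc hab hac hbc h1 h2
    have i1 : b ⊓ (a ⊔ c) = x := by
      rw [inf_sup_left, hinf xb xa hab.symm, hinf xb xc hbc, sup_idem]
    have i2 : c ⊓ (a ⊔ b) = x := by
      rw [inf_sup_left, hinf xc xa hac.symm, hinf xc xb hbc.symm, sup_idem]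
    have hbd : ¬b ≤ a ⊔ c := fun hle => xb.lt.ne ((inf_eq_left.2 hle).symm.trans i1).symm
    have ef : a ⊔ b ⋖ c ⊔ (a ⊔ b) := covBy_sup_of_inf_covBy_left (by rwa [i2])
    refine h.not_invSlope_between xa xb xc (d := a ⊔ c) (e := a ⊔ b) ?_ ?_ ?_ ef hbd ?_ h1 h2
    · rw [sup_comm]
      exact covBy_sup_of_inf_covBy_left (by rwa [hinf xc xa hac.symm])
    · exact covBy_sup_of_inf_covBy_left (by rwa [hinf xa xc hac])
    · exact covBy_sup_of_inf_covBy_left (by rwa [hinf xa xb hab])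
    · refine lt_of_le_of_ne (sup_le (le_sup_left.trans le_sup_right) le_sup_left) fun he => hbd ?_
      rw [he]
      exact le_sup_right.trans le_sup_right
  rcases (h.invSlope_ne xa xb hab).lt_or_gt with h1 | h1 <;>
    rcases (h.invSlope_ne xa xc hac).lt_or_gt with h2 | h2 <;>
    rcases (h.invSlope_ne xb xc hbc).lt_or_gt with h3 | h3
  · exact key xa xb xc hab hac hbc h1 h3
  · exact key xa xc xb hac hab hbc.symm h2 h3
  · exact lt_asymm (h1.trans h3) h2
  · exact key xc xa xb hac.symm hbc.symm hab h2 h1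
  · exact key xb xa xc hab.symm hbc hac h1 h2
  · exact lt_asymm (h1.trans h2) h3
  · exact key xb xc xa hbc hab.symm hac.symm h3 h2
  · exact key xc xb xa hbc.symm hac.symm hab.symm h3 h1

end IsPlanarDiagram

theorem IsPlanarOrder.joinIrrWidthLETwo {D : Type*} [DistribLattice D] [BoundedOrder D] [Finite D]
    (h : IsPlanarOrder D) : JoinIrrWidthLETwo D := by
  classical
  have := Fintype.ofFinite D
  obtain ⟨-, pos, hpos⟩ := h
  intro a b c ha hb hc
  by_contra! hcon
  obtain ⟨hab, hba, hac, hca, hbc, hcb⟩ := hcon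
  -- Primeness keeps `a, b, c` from lying below `x`, while everything strictly below one of them
  -- does; hence `x ⊔ a`, `x ⊔ b`, `x ⊔ c` are three distinct covers of `x`.
  let x : D := (Finset.univ.filter fun z => z < a ∨ z < b ∨ z < c).sup id
  have hxle : ∀ z, z < a ∨ z < b ∨ z < c → z ≤ x := fun z hz =>
    Finset.le_sup (f := id) (by simpa using hz)
  have hnle : ∀ {p}, SupIrred p → ¬p < a → ¬p < b → ¬p < c → ¬p ≤ x := by
    intro p hp h1 h2 h3 hle
    obtain ⟨z, hz, hpz⟩ := (supPrime_iff_supIrred.2 hp).le_finset_sup.1 hle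
    simp only [Finset.mem_filter, Finset.mem_univ, true_and, id] at hz hpz
    rcases hz with hz | hz | hz
    · exact h1 (hpz.trans_lt hz)
    · exact h2 (hpz.trans_lt hz)
    · exact h3 (hpz.trans_lt hz)
  have hax : ¬a ≤ x := hnle ha (lt_irrefl a) (fun h => hab h.le) fun h => hac h.le
  have hbx : ¬b ≤ x := hnle hb (fun h => hba h.le) (lt_irrefl b) fun h => hbc h.le
  have hcx : ¬c ≤ x := hnle hc (fun h => hca h.le) (fun h => hcb h.le) (lt_irrefl c)
  have hcov : ∀ {p}, ¬p ≤ x → (∀ z < p, z ≤ x) → x ⋖ x ⊔ p := by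
    intro p hp hlow
    rw [sup_comm]
    refine covBy_sup_of_inf_covBy_left ⟨inf_le_left.lt_of_ne fun he => hp (inf_eq_left.1 he), ?_⟩
    intro z hz hzp
    exact hz.not_ge (le_inf hzp.le (hlow z hzp))
  have hne : ∀ {p q}, SupIrred p → ¬p ≤ x → ¬p ≤ q → x ⊔ p ≠ x ⊔ q := by
    intro p q hp hpx hpq he
    rcases hp.le_sup_iff.1 (le_sup_right.trans_eq he) with h | h
    · exact hpx h
    · exact hpq h
  exact hpos.not_three_covers (hcov hax fun z hz => hxle z (.inl hz))
    (hcov hbx fun z hz => hxle z (.inr (.inl hz))) (hcov hcx fun z hz => hxle z (.inr (.inr hz)))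
    (hne ha hax hab) (hne ha hax hac) (hne hb hbx hbc)

end Planar

theorem proposition1p5 {D : Type*} [DistribLattice D] [BoundedOrder D] [Finite D] :
    FullyChainRepresentable D ↔
      IsPlanarOrder D ∧ {c : D | IsCoatom c ∧ JoinReducible c}.Subsingleton :=
  ⟨fun h => ⟨h.joinIrrWidthLETwo.isPlanarOrder, h.subsingleton_joinReducible_coatom⟩,
    fun h => h.1.joinIrrWidthLETwo.fullyChainRepresentable h.2⟩
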